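/- **Setting.** A sublinear expectation space $(\Omega,\mathcal H,\hat{\mathbb E})$ consists of a set $\Omega$, a linear space $\mathcal H$ of real functions on $\Omega$ such that $\varphi(X_1,\dots,X_n)\in\mathcal H$ whenever $X_1,\dots,X_n\in\mathcal H$ and $\varphi:\mathbb R^n\to\mathbb R$ is Lipschitz, and a functional $\hat{\mathbb E}:\mathcal H\to\mathbb R$ that is monotone, preserves constants, is positively homogeneous, and satisfies $\hat{\mathbb E}[X]-\hat{\mathbb E}[Y]\le\hat{\mathbb E}[X-Y]$. Random vectors $X,X'$ (possibly on different spaces) are identically distributed if $\hat{\mathbb E}[\varphi(X)]=\hat{\mathbb E}'[\varphi(X')]$ for all Lipschitz $\varphi$; $Y$ is independent from $X$ if $\hat{\mathbb E}[\varphi(X,Y)]=\hat{\mathbb E}\big[\hat{\mathbb E}[\varphi(x,Y)]_{x=X}\big]$ for all Lipschitz $\varphi$. A càdlàg process $(X_t)_{t\ge0}$ with $X_t\in\mathcal H^d$ is a Lévy process if $X_0=0$, if for all $t,s>0$ and $0\le t_1\le\dots\le t_n\le t$ the increment $X_{t+s}-X_t$ is independent from $(X_{t_1},\dots,X_{t_n})$,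 and if the distribution of $X_{t+s}-X_t$ does not depend on $t$. A $d$-dimensional Lévy process $X$ is a $G$-Lévy process if there is a $2d$-dimensional Lévy process $(X^c_t,X^d_t)_{t\ge0}$, on the same or on another sublinear expectation space (whose expectation is again written $\hat{\mathbb E}$), such that $X$ and $X^c+X^d$ have the same finite-dimensional distributions and $$\lim_{t\downarrow0}\hat{\mathbb E}[|X^c_t|^3]\,t^{-1}=0,\qquad \hat{\mathbb E}[|X^d_t|]\le Ct\quad(t\ge0)$$ for some constant $C$, where it is understood that $|X^c_t|^3$ belongs to the domain of the expectation for all sufficiently small $t>0$. **Theorem.** Let $(X_t)_{t\ge0}$ be a $d$-dimensional $G$-Lévy process on $(\Omega,\mathcal H,\hat{\mathbb E})$. (i) For every $f\in C_b^3(\mathbb R^d)$ (three times continuously differentiable, bounded together with its derivatives up to order 3) with $f(0)=0$, the limit $$G_X[f(\cdot)]:=\lim_{\delta\downarrow0}\hat{\mathbb E}[f(X_\delta)]\,\delta^{-1}$$ exists in $\mathbb R$. (ii) For every bounded Lipschitz $\varphi:\mathbb R^d\to\mathbb R$, the function $u(t,x)=\hat{\mathbb E}[\varphi(x+X_t)]$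 on $[0,\infty)\times\mathbb R^d$ is a viscosity solution of $$\partial_tu(t,x)-G_X[u(t,x+\cdot)-u(t,x)]=0,\qquad u(0,x)=\varphi(x).$$ That is: $u$ is bounded and continuous, $u(0,\cdot)=\varphi$, and for every $(t,x)\in(0,\infty)\times\mathbb R^d$ and every $\psi\in C_b^{2,3}((0,\infty)\times\mathbb R^d)$ with $\psi(t,x)=u(t,x)$ one has $$\partial_t\psi(t,x)-G_X[\psi(t,x+\cdot)-\psi(t,x)]\le0\quad\text{if }\psi\ge u\text{ on }(0,\infty)\times\mathbb R^d,$$ $$\partial_t\psi(t,x)-G_X[\psi(t,x+\cdot)-\psi(t,x)]\ge0\quad\text{if }\psi\le u\text{ on }(0,\infty)\times\mathbb R^d.$$ Here $\psi\in C_b^{2,3}$ means that $\psi$, $\partial_t\psi$, $\partial_t^2\psi$ and the $x$-derivatives of $\psi$ up to order 3 exist, are jointly continuous, and are bounded on $(0,\infty)\times\mathbb R^d$. -/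

import Mathlib

open Filter Topology
open scoped NNReal

universe u

/-- A function is (globally) Lipschitz. -/
def IsLip {F : Type*} [PseudoMetricSpace F] (φ : F → ℝ) : Prop :=
  ∃ K : ℝ≥0, LipschitzWith K φ

/-- The class `C_{b.Lip}` of bounded Lipschitz functions. -/
def IsBddLip {F : Type*} [PseudoMetricSpace F] (φ : F → ℝ) : Prop :=
  IsLip φ ∧ ∃ M : ℝ, ∀ x, |φ x| ≤ M

/-- A sublinear expectation space `(Ω, H, E)`: `H` is a linear space of real functions on `Ω` that is
stable under Lipschitz functions of finitely many of its elements, and `E` is a sublinear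
expectation on `H`. The functional `E` is written as a function of all `X : Ω → ℝ`, but it is
constrained, and meaningful, on `H` only. -/
structure SublinearExpectationSpace (Ω : Type u) where
  H : Submodule ℝ (Ω → ℝ)
  lip_mem : ∀ (n : ℕ) (X : Fin n → Ω → ℝ), (∀ i, X i ∈ H) →
    ∀ φ : (Fin n → ℝ) → ℝ, IsLip φ → (fun ω => φ (fun i => X i ω)) ∈ H
  E : (Ω → ℝ) → ℝ
  mono : ∀ X ∈ H, ∀ Y ∈ H, (∀ ω, Y ω ≤ X ω) → E Y ≤ E X
  const : ∀ c : ℝ, E (fun _ => c) = c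
  subadd : ∀ X ∈ H, ∀ Y ∈ H, E X - E Y ≤ E (X - Y)
  pos_homog : ∀ X ∈ H, ∀ c : ℝ, 0 ≤ c → E (c • X) = c * E X

namespace SublinearExpectationSpace

/-- `X ∈ H^d`: all coordinates (equivalently, all linear functionals) of `X` belong to `H`. -/
def IsRandomVector {Ω : Type*} (S : SublinearExpectationSpace Ω) {V : Type*}
    [NormedAddCommGroup V] [NormedSpace ℝ V] (X : Ω → V) : Prop :=
  ∀ l : V →L[ℝ] ℝ, (fun ω => l (X ω)) ∈ S.H

/-- `X` and `X'`, possibly on different sublinear expectation spaces, are identically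
distributed. -/
def IdentDist {Ω Ω' : Type*} (S : SublinearExpectationSpace Ω) (S' : SublinearExpectationSpace Ω')
    {F : Type*} [PseudoMetricSpace F] (X : Ω → F) (X' : Ω' → F) : Prop :=
  ∀ φ : F → ℝ, IsLip φ → S.E (fun ω => φ (X ω)) = S'.E (fun ω => φ (X' ω))

/-- `Y` is independent from `X`: `E[φ(X, Y)] = E[E[φ(x, Y)]_{x = X}]` for all Lipschitz `φ`. -/
def IndepFrom {Ω : Type*} (S : SublinearExpectationSpace Ω)
    {F F' : Type*} [PseudoMetricSpace F] [PseudoMetricSpace F'] (Y : Ω → F') (X : Ω → F) : Prop :=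
  ∀ φ : F × F' → ℝ, IsLip φ →
    S.E (fun ω => φ (X ω, Y ω)) = S.E (fun ω => S.E (fun ω' => φ (X ω, Y ω')))

/-- A Lévy process under a sublinear expectation, with values in `V` (which is `ℝ^d` or
`ℝ^d × ℝ^d` below; on a product the maximum norm gives the same Lipschitz functions as the
Euclidean norm). -/
structure IsLevy {Ω : Type*} (S : SublinearExpectationSpace Ω) {V : Type*}
    [NormedAddCommGroup V] [NormedSpace ℝ V] (X : ℝ≥0 → Ω → V) : Prop where
  mem : ∀ t, S.IsRandomVector (X t)
  right_cont : ∀ ω t, Tendsto (fun s => X s ω) (𝓝[>] t) (𝓝 (X t ω))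
  left_lim : ∀ ω t, ∃ l : V, Tendsto (fun s => X s ω) (𝓝[<] t) (𝓝 l)
  zero : ∀ ω, X 0 ω = 0
  indep : ∀ t s : ℝ≥0, 0 < t → 0 < s → ∀ (n : ℕ) (τ : Fin n → ℝ≥0), Monotone τ →
    (∀ i, τ i ≤ t) →
    S.IndepFrom (fun ω => X (t + s) ω - X t ω) (fun ω => fun i => X (τ i) ω)
  stationary : ∀ t t' s : ℝ≥0,
    S.IdentDist S (fun ω => X (t + s) ω - X t ω) (fun ω => X (t' + s) ω - X t' ω)

/-- The pair `(Xc, Xd)` is a Lévy process with values in `V × V` such that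
`lim_{t ↓ 0} E[|Xc_t|³] / t = 0` (in particular `|Xc_t|³ ∈ H` for small `t`), and
`E[|Xd_t|] ≤ C t` for all `t ≥ 0`. -/
structure IsGLevyPair {Ω : Type*} (S : SublinearExpectationSpace Ω) {V : Type*}
    [NormedAddCommGroup V] [NormedSpace ℝ V] (Xc Xd : ℝ≥0 → Ω → V) : Prop where
  levy : S.IsLevy (fun t ω => (Xc t ω, Xd t ω))
  cube_mem : ∀ᶠ t in 𝓝[>] (0 : ℝ≥0), (fun ω => ‖Xc t ω‖ ^ 3) ∈ S.H
  cube_lim : Tendsto (fun t : ℝ≥0 => S.E (fun ω => ‖Xc t ω‖ ^ 3) / (t : ℝ)) (𝓝[>] 0) (𝓝 0)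
  jump_bound : ∃ C : ℝ, ∀ t : ℝ≥0, S.E (fun ω => ‖Xd t ω‖) ≤ C * t

/-- A `G`-Lévy process: a Lévy process `X` which is, in the sense of finite dimensional
distributions, a sum `Xc + Xd` with `(Xc, Xd)` as in `IsGLevyPair`. The pair may live on another
sublinear expectation space; the case of a pointwise decomposition on the same space is
included. -/
structure IsGLevy {Ω : Type u} (S : SublinearExpectationSpace Ω) {V : Type*}
    [NormedAddCommGroup V] [NormedSpace ℝ V] (X : ℝ≥0 → Ω → V) : Prop where
  levy : S.IsLevy X
  decomp : ∃ (Ω' : Type u) (S' : SublinearExpectationSpace Ω') (Xc Xd : ℝ≥0 → Ω' → V),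
    S'.IsGLevyPair Xc Xd ∧
    ∀ (n : ℕ) (τ : Fin n → ℝ≥0),
      S.IdentDist S' (fun ω => fun i => X (τ i) ω) (fun ω => fun i => Xc (τ i) ω + Xd (τ i) ω)

/-- The nonlocal operator `G_X[f] = lim_{δ ↓ 0} E[f(X_δ)] / δ`. -/
noncomputable def generator {Ω : Type*} (S : SublinearExpectationSpace Ω) {V : Type*}
    (X : ℝ≥0 → Ω → V) (f : V → ℝ) : ℝ :=
  limUnder (𝓝[>] (0 : ℝ≥0)) (fun δ => S.E (fun ω => f (X δ ω)) / (δ : ℝ))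

end SublinearExpectationSpace

/-- The class `C_b^k(V)`: `k` times continuously differentiable, with bounded derivatives of all
orders `0, …, k`. -/
def IsCb {V : Type*} [NormedAddCommGroup V] [NormedSpace ℝ V] (k : ℕ) (f : V → ℝ) : Prop :=
  ContDiff ℝ k f ∧ ∀ j ≤ k, ∃ M : ℝ, ∀ x, ‖iteratedFDeriv ℝ j f x‖ ≤ M

/-- The class `C_b^{2,3}((0, ∞) × V)`: functions `ψ(t, x)` that are twice continuously
differentiable in `t` and three times in `x`, all these derivatives (`ψ` itself included) being
jointly continuous and bounded on `(0, ∞) × V`. Values at `t ≤ 0` play no role. -/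
structure IsCb23 {V : Type*} [NormedAddCommGroup V] [NormedSpace ℝ V] (ψ : ℝ → V → ℝ) : Prop where
  contDiff_time : ∀ x, ContDiffOn ℝ 2 (fun t => ψ t x) (Set.Ioi 0)
  contDiff_space : ∀ t, 0 < t → ContDiff ℝ 3 (ψ t)
  time_cont : ∀ k ≤ 2, ContinuousOn
    (fun p : ℝ × V => iteratedDeriv k (fun s => ψ s p.2) p.1) (Set.Ioi 0 ×ˢ Set.univ)
  space_cont : ∀ k ≤ 3, ContinuousOn
    (fun p : ℝ × V => iteratedFDeriv ℝ k (ψ p.1) p.2) (Set.Ioi 0 ×ˢ Set.univ)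
  time_bdd : ∀ k ≤ 2, ∃ M : ℝ, ∀ t, 0 < t → ∀ x, |iteratedDeriv k (fun s => ψ s x) t| ≤ M
  space_bdd : ∀ k ≤ 3, ∃ M : ℝ, ∀ t, 0 < t → ∀ x, ‖iteratedFDeriv ℝ k (ψ t) x‖ ≤ M

/-- Bounded upper semicontinuous viscosity subsolutions on `[0, ∞) × V` of
`∂_t u(t,x) - G[u(t,x+·) - u(t,x)] = 0`, `u(0,·) = φ`. -/
structure IsViscositySubsolution {V : Type*} [NormedAddCommGroup V] [NormedSpace ℝ V]
    (G : (V → ℝ) → ℝ) (φ : V → ℝ) (u : ℝ≥0 → V → ℝ) : Prop where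
  bdd : ∃ M : ℝ, ∀ t x, |u t x| ≤ M
  usc : UpperSemicontinuous (fun p : ℝ≥0 × V => u p.1 p.2)
  init : ∀ x, u 0 x ≤ φ x
  sub : ∀ (t : ℝ≥0) (x : V), 0 < t → ∀ ψ : ℝ → V → ℝ, IsCb23 ψ →
    (∀ (s : ℝ≥0) (y : V), 0 < s → u s y ≤ ψ s y) → ψ t x = u t x →
    deriv (fun s => ψ s x) t - G (fun z => ψ t (x + z) - ψ t x) ≤ 0

/-- Bounded lower semicontinuous viscosity supersolutions on `[0, ∞) × V` of
`∂_t u(t,x) - G[u(t,x+·) - u(t,x)] = 0`, `u(0,·) = φ`. -/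
structure IsViscositySupersolution {V : Type*} [NormedAddCommGroup V] [NormedSpace ℝ V]
    (G : (V → ℝ) → ℝ) (φ : V → ℝ) (u : ℝ≥0 → V → ℝ) : Prop where
  bdd : ∃ M : ℝ, ∀ t x, |u t x| ≤ M
  lsc : LowerSemicontinuous (fun p : ℝ≥0 × V => u p.1 p.2)
  init : ∀ x, φ x ≤ u 0 x
  super : ∀ (t : ℝ≥0) (x : V), 0 < t → ∀ ψ : ℝ → V → ℝ, IsCb23 ψ →
    (∀ (s : ℝ≥0) (y : V), 0 < s → ψ s y ≤ u s y) → ψ t x = u t x →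
    0 ≤ deriv (fun s => ψ s x) t - G (fun z => ψ t (x + z) - ψ t x)

/-- Bounded continuous viscosity solutions on `[0, ∞) × V` of
`∂_t u(t,x) - G[u(t,x+·) - u(t,x)] = 0`, `u(0,·) = φ`. -/
structure IsViscositySolution {V : Type*} [NormedAddCommGroup V] [NormedSpace ℝ V]
    (G : (V → ℝ) → ℝ) (φ : V → ℝ) (u : ℝ≥0 → V → ℝ) : Prop where
  bdd : ∃ M : ℝ, ∀ t x, |u t x| ≤ M
  cont : Continuous (fun p : ℝ≥0 × V => u p.1 p.2)
  sub : IsViscositySubsolution G φ u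
  super : IsViscositySupersolution G φ u

/-!
The decomposition `X = X^c + X^d` gives `E‖X_t‖ → 0` as `t ↓ 0`. With `q x = √(1 + ‖x‖²) - 1`, the
quantitative convexity inequality `q (x + y) ≥ q x + ∇q(x) · y + (1 - ‖x‖) / 2 * q y`, integrated
over independent increments, shows that `t ↦ E[q(X_t)]` is superadditive up to a constant factor
and a linear error, and such a function is `O(t)` if it is bounded above near `0`. The same argument
for linear functionals gives `E[l(X_t)] = O(t)`. Since `min ‖x‖ ‖x‖²` is comparable to `q`, a
second order Taylor estimate yields `|E[g(X_t)] - g 0| ≤ C L t`, where `L` bounds the `C^{1,1}`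
size of `g`.

For `f ∈ C_b^3` with `f 0 = 0` the function `y ↦ f (x + y) - f y` has `C^{1,1}` size `O(‖x‖)`, so
`E[f(X_{t+s})] ≤ E[f(X_t)] + E[f(X_s)] + o(1) s` as `t ↓ 0`, and Fekete's lemma at `0` gives the
limit defining the generator. Viscosity inequalities come from comparing the dynamic programming
identity `u(t, x) = E[u(t - δ, x + X_δ)]` with the expansion
`E[ψ(t - δ, x + X_δ)] = ψ(t, x) + δ (G_X[ψ(t, x + ·) - ψ(t, x)] - ∂_t ψ(t, x)) + o(δ)`.
-/

section Lipschitz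

variable {F F' V : Type*} [PseudoMetricSpace F] [PseudoMetricSpace F'] [NormedAddCommGroup V]

theorem IsLip.const (c : ℝ) : IsLip fun _ : F => c :=
  ⟨0, LipschitzWith.const c⟩

theorem IsLip.comp {φ : F → ℝ} (hφ : IsLip φ) {g : F' → F} {K : ℝ≥0} (hg : LipschitzWith K g) :
    IsLip fun x => φ (g x) :=
  let ⟨L, hL⟩ := hφ
  ⟨L * K, hL.comp hg⟩

theorem IsLip.norm : IsLip fun x : V => ‖x‖ :=
  ⟨1, lipschitzWith_one_norm⟩

theorem IsLip.comp_const_add {φ : V → ℝ} (hφ : IsLip φ) (x : V) : IsLip fun y => φ (x + y) :=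
  hφ.comp (isometry_add_left x).lipschitz

end Lipschitz

namespace SublinearExpectationSpace

variable {Ω : Type*} {S : SublinearExpectationSpace Ω} {V W : Type*} [NormedAddCommGroup V]
  [NormedSpace ℝ V] [NormedAddCommGroup W] [NormedSpace ℝ W]

section Basic

variable (S) {A B D : Ω → ℝ}

theorem const_mem (c : ℝ) : (fun _ : Ω => c) ∈ S.H :=
  S.lip_mem 0 (fun _ _ => 0) (fun i => i.elim0) (fun _ => c) (IsLip.const c)

theorem const_mul_mem (hA : A ∈ S.H) (c : ℝ) : (fun ω => c * A ω) ∈ S.H :=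
  S.H.smul_mem c hA

theorem E_mono (hA : A ∈ S.H) (hB : B ∈ S.H) (h : ∀ ω, A ω ≤ B ω) : S.E A ≤ S.E B :=
  S.mono B hB A hA h

theorem E_nonneg (hA : A ∈ S.H) (h : ∀ ω, 0 ≤ A ω) : 0 ≤ S.E A :=
  S.const 0 ▸ S.E_mono (S.const_mem 0) hA h

theorem E_add_le (hA : A ∈ S.H) (hB : B ∈ S.H) :
    S.E (fun ω => A ω + B ω) ≤ S.E A + S.E B := by
  have h := S.subadd (A + B) (S.H.add_mem hA hB) B hB
  rw [add_sub_cancel_right] at h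
  exact sub_le_iff_le_add.1 h

theorem E_add_const (hA : A ∈ S.H) (c : ℝ) : S.E (fun ω => A ω + c) = S.E A + c := by
  have hle : ∀ {A : Ω → ℝ}, A ∈ S.H → ∀ c, S.E (fun ω => A ω + c) ≤ S.E A + c :=
    fun hA c => (S.E_add_le hA (S.const_mem c)).trans_eq (by rw [S.const])
  refine le_antisymm (hle hA c) ?_
  have h := hle (S.H.add_mem hA (S.const_mem c)) (-c)
  simp only [Pi.add_apply, add_neg_cancel_right] at h
  exact le_sub_iff_add_le.1 (h.trans_eq (sub_eq_add_neg _ _).symm)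

theorem E_const_mul (hA : A ∈ S.H) {c : ℝ} (hc : 0 ≤ c) :
    S.E (fun ω => c * A ω) = c * S.E A :=
  S.pos_homog A hA c hc

theorem neg_E_neg_le (hA : A ∈ S.H) : -S.E (fun ω => -A ω) ≤ S.E A := by
  have h := S.E_add_le hA (S.H.neg_mem hA)
  simp only [Pi.neg_apply, add_neg_cancel, S.const] at h
  exact neg_le_iff_add_nonneg.2 h

theorem mul_E_le (hA : A ∈ S.H) (c : ℝ) : c * S.E A ≤ S.E fun ω => c * A ω := by
  rcases le_total 0 c with hc | hc
  · exact (S.E_const_mul hA hc).ge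
  · have h := S.neg_E_neg_le (S.const_mul_mem hA c)
    simp only [← neg_mul] at h
    rwa [S.E_const_mul hA (neg_nonneg.2 hc), neg_mul, neg_neg] at h

theorem abs_E_sub_le (hA : A ∈ S.H) (hB : B ∈ S.H) (hD : D ∈ S.H)
    (h : ∀ ω, |A ω - B ω| ≤ D ω) : |S.E A - S.E B| ≤ S.E D := by
  have hle : ∀ {A B : Ω → ℝ}, A ∈ S.H → B ∈ S.H → (∀ ω, |A ω - B ω| ≤ D ω) →
      S.E A - S.E B ≤ S.E D := fun hA hB h =>
    (S.subadd _ hA _ hB).trans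
      (S.E_mono (S.H.sub_mem hA hB) hD fun ω => (le_abs_self _).trans (h ω))
  exact abs_sub_le_iff.2 ⟨hle hA hB h, hle hB hA fun ω => abs_sub_comm (A ω) _ ▸ h ω⟩

end Basic

section RandomVector

variable {Y : Ω → V}

theorem IsRandomVector.lip_mem [FiniteDimensional ℝ V] (hY : S.IsRandomVector Y) {φ : V → ℝ}
    (hφ : IsLip φ) : (fun ω => φ (Y ω)) ∈ S.H := by
  let e : V ≃L[ℝ] (Fin (Module.finrank ℝ V) → ℝ) := ContinuousLinearEquiv.ofFinrankEq (by simp)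
  have h := S.lip_mem _ (fun i ω => e (Y ω) i)
    (fun i => hY ((ContinuousLinearMap.proj (R := ℝ) (φ := fun _ => ℝ) i).comp
      (e : V →L[ℝ] (Fin (Module.finrank ℝ V) → ℝ))))
    (fun y => φ (e.symm y)) (hφ.comp e.symm.lipschitz)
  simpa only [ContinuousLinearEquiv.symm_apply_apply] using h

theorem IsRandomVector.map (hY : S.IsRandomVector Y) (l : V →L[ℝ] W) :
    S.IsRandomVector fun ω => l (Y ω) :=
  fun k => hY (k.comp l)

variable (S) in
/-- The transition operator `φ ↦ E[φ(· + Y)]`. For `Y = X_t` with a Lévy process `X` these operators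
form a sublinear semigroup. -/
def transition (Y : Ω → V) (φ : V → ℝ) (x : V) : ℝ :=
  S.E fun ω => φ (x + Y ω)

theorem IsRandomVector.lipschitzWith_transition [FiniteDimensional ℝ V]
    (hY : S.IsRandomVector Y) {K : ℝ≥0} {φ : V → ℝ} (hφ : LipschitzWith K φ) :
    LipschitzWith K (S.transition Y φ) := by
  refine LipschitzWith.of_dist_le_mul fun x y => ?_
  rw [Real.dist_eq, ← S.const (K * dist x y)]
  have hmem (x : V) : (fun ω => φ (x + Y ω)) ∈ S.H :=
    hY.lip_mem (IsLip.comp_const_add ⟨K, hφ⟩ x)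
  refine S.abs_E_sub_le (hmem x) (hmem y) (S.const_mem _) fun ω => ?_
  simpa only [Real.dist_eq, dist_add_right] using hφ.dist_le_mul (x + Y ω) (y + Y ω)

end RandomVector

section Semigroup

variable {X : ℝ≥0 → Ω → V}

theorem IsLevy.map (hX : S.IsLevy X) (l : V →L[ℝ] W) : S.IsLevy fun t ω => l (X t ω) where
  mem t := (hX.mem t).map l
  right_cont ω t := (l.continuous.tendsto _).comp (hX.right_cont ω t)
  left_lim ω t :=
    let ⟨x, hx⟩ := hX.left_lim ω t
    ⟨l x, (l.continuous.tendsto _).comp hx⟩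
  zero ω := by rw [hX.zero, map_zero]
  indep t s ht hs n τ hτ hτt φ hφ := by
    have hl : LipschitzWith ‖l‖₊ fun (x : Fin n → V) i => l (x i) :=
      LipschitzWith.of_dist_le_mul fun x y => (dist_pi_le_iff (by positivity)).2 fun i =>
        (l.lipschitz.dist_le_mul _ _).trans (by gcongr; exact dist_le_pi_dist x y i)
    simpa only [map_sub, Function.comp_apply] using hX.indep t s ht hs n τ hτ hτt _
      (hφ.comp ((hl.comp LipschitzWith.prod_fst).prodMk (l.lipschitz.comp LipschitzWith.prod_snd)))
  stationary t t' s φ hφ := by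
    simpa only [map_sub] using hX.stationary t t' s _ (hφ.comp l.lipschitz)

theorem IsLevy.E_comp_add (hX : S.IsLevy X) (t s : ℝ≥0) {φ : V → ℝ} (hφ : IsLip φ) :
    S.E (fun ω => φ (X (t + s) ω)) = S.E fun ω => S.transition (X s) φ (X t ω) := by
  unfold transition
  rcases eq_zero_or_pos t with rfl | ht
  · simp only [hX.zero, zero_add, S.const]
  rcases eq_zero_or_pos s with rfl | hs
  · simp only [hX.zero, add_zero, S.const]
  have hadd : LipschitzWith (1 + 1) fun p : (Fin 1 → V) × V => p.1 0 + p.2 :=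
    LipschitzWith.add (by simpa only [one_mul, Function.comp_def] using
      (LipschitzWith.eval (α := fun _ : Fin 1 => V) 0).comp LipschitzWith.prod_fst)
      LipschitzWith.prod_snd
  have h := hX.indep t s ht hs 1 (fun _ => t) monotone_const (fun _ => le_rfl) _ (hφ.comp hadd)
  simp only [add_sub_cancel] at h
  rw [h]
  congr 1 with ω
  simpa only [zero_add, hX.zero, sub_zero] using
    hX.stationary t 0 s _ (hφ.comp_const_add (X t ω))

theorem IsLevy.transition_add (hX : S.IsLevy X) (t s : ℝ≥0) {φ : V → ℝ} (hφ : IsLip φ) (x : V) :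
    S.transition (X (t + s)) φ x = S.transition (X t) (S.transition (X s) φ) x := by
  simpa only [transition, add_assoc] using hX.E_comp_add t s (hφ.comp_const_add x)

end Semigroup

end SublinearExpectationSpace

section AlmostAdditive

variable {a : ℝ≥0 → ℝ} {ε s : ℝ≥0}

theorem exists_eq_nat_mul_add (hs : 0 < s) (T : ℝ≥0) :
    ∃ n : ℕ, ∃ r < s, T = n * s + r := by
  have hle : ⌊T / s⌋₊ * s ≤ T := (le_div_iff₀ hs).1 (Nat.floor_le zero_le)
  refine ⟨⌊T / s⌋₊, T - ⌊T / s⌋₊ * s, ?_, (add_tsub_cancel_of_le hle).symm⟩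
  rw [tsub_lt_iff_left hle, ← add_one_mul]
  exact (div_lt_iff₀ hs).1 (Nat.lt_floor_add_one _)

theorem nat_mul_le_of_add_le {c : ℝ} (h0 : 0 ≤ a 0) (h : ∀ t, t + s ≤ ε → a t + c ≤ a (t + s))
    (n : ℕ) (hn : n * s ≤ ε) : n * c ≤ a (n * s) := by
  induction n with
  | zero => simpa only [Nat.cast_zero, zero_mul] using h0
  | succ n ih =>
    rw [Nat.cast_succ, add_one_mul] at hn ⊢
    rw [Nat.cast_succ, add_one_mul]
    linarith [ih (le_self_add.trans hn), h _ hn]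

theorem le_mul_of_almost_superadditive {B c K : ℝ} (hc : 0 < c) (h0 : a 0 = 0)
    (hB : ∀ t ≤ ε, a t ≤ B) (h : ∀ t s, t + s ≤ ε → a t + c * a s - K * s ≤ a (t + s))
    (hs : s ≤ ε) : a s ≤ (K + 2 * B / ε) / c * s := by
  rcases eq_zero_or_pos s with rfl | hs0
  · simp [h0]
  obtain ⟨n, r, hr, hε⟩ := exists_eq_nat_mul_add hs0 ε
  have hiter : n * (c * a s - K * s) ≤ B :=
    (nat_mul_le_of_add_le h0.ge (fun t ht => by linarith [h t s ht]) n (hε ▸ le_self_add)).trans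
      (hB _ (hε ▸ le_self_add))
  have hn : 1 ≤ n := by
    by_contra! hn
    rw [Nat.lt_one_iff.1 hn, Nat.cast_zero, zero_mul, zero_add] at hε
    exact (hs.trans_eq hε).not_gt hr
  have hεle : (ε : ℝ) ≤ 2 * (n * s) := by
    have hns : (s : ℝ) ≤ n * s := le_mul_of_one_le_left s.2 (by exact_mod_cast hn)
    have : (ε : ℝ) = n * s + r := by exact_mod_cast hε
    linarith [NNReal.coe_lt_coe.2 hr]
  have hεpos : (0 : ℝ) < ε := hs0.trans_le hs
  have hB0 : 0 ≤ B := h0 ▸ hB 0 zero_le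
  have key : (c * a s - K * s) * ε ≤ 2 * B * s := by
    rcases le_total (c * a s - K * s) 0 with hneg | hpos
    · exact (mul_nonpos_of_nonpos_of_nonneg hneg hεpos.le).trans (by positivity)
    · nlinarith [mul_le_mul_of_nonneg_left hεle hpos, mul_le_mul_of_nonneg_right hiter s.2]
  rw [div_mul_eq_mul_div, le_div_iff₀ hc, add_mul, div_mul_eq_mul_div, mul_comm (a s),
    ← sub_le_iff_le_add', le_div_iff₀ hεpos]
  exact key

theorem div_le_div_add_of_almost_subadditive {C η : ℝ} (hC : ∀ t ≤ ε, |a t| ≤ C * t)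
    (h : ∀ t s, t + s ≤ ε → a (t + s) ≤ a t + a s + η * s) {T : ℝ≥0} (hs : 0 < s) (hsT : s ≤ T)
    (hT : T ≤ ε) : a T / T ≤ a s / s + η + 2 * C * s / T := by
  obtain ⟨n, r, hr, hTn⟩ := exists_eq_nat_mul_add hs T
  have hs' : (0 : ℝ) < s := hs
  have hTpos : (0 : ℝ) < T := hs.trans_le hsT
  have hC0 : 0 ≤ C := nonneg_of_mul_nonneg_left ((abs_nonneg _).trans (hC s (hsT.trans hT))) hs'
  have ha0 : a 0 = 0 := abs_nonpos_iff.1 ((hC 0 zero_le).trans_eq (by simp))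
  have hns : n * s ≤ ε := (hTn ▸ le_self_add : n * s ≤ T).trans hT
  have hiter : n * (-(a s + η * s)) ≤ -a (n * s) :=
    nat_mul_le_of_add_le (a := fun t => -a t) (by simp [ha0])
      (fun t ht => by linarith [h t s ht]) n hns
  have hsplit : a T ≤ a (n * s) + a r + η * r := hTn ▸ h _ _ (hTn ▸ hT)
  have hr' : (r : ℝ) ≤ s := NNReal.coe_le_coe.2 hr.le
  have har : a r ≤ C * r := (le_abs_self _).trans (hC r (hr.le.trans (hsT.trans hT)))
  have hslope : -C ≤ a s / s := by
    rw [le_div_iff₀ hs']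
    linarith [neg_abs_le (a s), hC s (hsT.trans hT)]
  have hnT : (n : ℝ) * s = T - r := eq_sub_of_add_eq (by exact_mod_cast hTn.symm)
  have hnas : n * a s = (T - r) * (a s / s) := by
    rw [← hnT]
    field_simp
  rw [div_le_iff₀ hTpos, add_mul, div_mul_cancel₀ _ hTpos.ne']
  have hrs : C * r ≤ C * s := mul_le_mul_of_nonneg_left hr' hC0
  linarith [mul_le_mul_of_nonneg_left hslope r.coe_nonneg,
    show n * (η * s) = η * (T - r) by rw [← hnT]; ring]

-- Fekete's lemma at `0` instead of `∞`.
theorem exists_tendsto_div_of_almost_subadditive {C : ℝ} (hC : ∀ᶠ t in 𝓝 0, |a t| ≤ C * t)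
    (h : ∀ η > 0, ∃ ε > 0, ∀ t s, t + s ≤ ε → a (t + s) ≤ a t + a s + η * s) :
    ∃ l, Tendsto (fun t => a t / t) (𝓝[>] 0) (𝓝 l) := by
  have hbdd : ∀ᶠ t in 𝓝[>] (0 : ℝ≥0), |a t / t| ≤ C := by
    filter_upwards [nhdsWithin_le_nhds hC, self_mem_nhdsWithin] with t ht ht0
    rwa [abs_div, NNReal.abs_eq, div_le_iff₀ (NNReal.coe_pos.2 ht0)]
  have hle : IsBoundedUnder (· ≤ ·) (𝓝[>] (0 : ℝ≥0)) fun t => a t / t :=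
    ⟨C, hbdd.mono fun t ht => (abs_le.1 ht).2⟩
  have hge : IsBoundedUnder (· ≥ ·) (𝓝[>] (0 : ℝ≥0)) fun t => a t / t :=
    ⟨-C, hbdd.mono fun t ht => (abs_le.1 ht).1⟩
  refine ⟨_, tendsto_of_le_liminf_of_limsup_le le_rfl (le_of_forall_pos_le_add fun η hη => ?_)
    hle hge⟩
  obtain ⟨δ, hδ, hCδ⟩ := nhds_bot_basis_Iic.eventually_iff.1 hC
  obtain ⟨ε, hε, hsub⟩ := h (η / 2) (half_pos hη)
  refine limsup_le_of_le hge.isCoboundedUnder_le ?_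
  filter_upwards [Ioc_mem_nhdsGT (lt_min hδ hε)] with T ⟨hT0, hT⟩
  rw [← sub_le_iff_le_add]
  refine le_liminf_of_le hle.isCoboundedUnder_ge ?_
  have hsmall : Tendsto (fun s : ℝ≥0 => 2 * C * s / T) (𝓝[>] 0) (𝓝 0) :=
    (Continuous.tendsto' (by fun_prop) _ _ (by simp)).mono_left nhdsWithin_le_nhds
  filter_upwards [hsmall.eventually_le_const (half_pos hη), Ioc_mem_nhdsGT hT0]
    with s hs ⟨hs0, hsT⟩
  linarith [div_le_div_add_of_almost_subadditive
    (fun t ht => hCδ (ht.trans (min_le_left δ ε)))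
    (fun t s hts => hsub t s (hts.trans (min_le_right δ ε))) hs0 hsT hT]

end AlmostAdditive

section SoftNorm

variable {V W : Type*} [NormedAddCommGroup V] [NormedAddCommGroup W]

/-- A smooth substitute for `min ‖x‖ (‖x‖ ^ 2)`, to which it is comparable. -/
noncomputable def softNorm (x : V) : ℝ := √(1 + ‖x‖ ^ 2) - 1

theorem one_add_softNorm_sq (x : V) : (1 + softNorm x) ^ 2 = 1 + ‖x‖ ^ 2 := by
  rw [softNorm, add_sub_cancel, Real.sq_sqrt (by positivity)]

theorem softNorm_nonneg (x : V) : 0 ≤ softNorm x :=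
  sub_nonneg.2 <| Real.one_le_sqrt.2 <| le_add_of_nonneg_right <| sq_nonneg _

theorem softNorm_zero : softNorm (0 : V) = 0 := by
  simp [softNorm]

theorem softNorm_le_norm (x : V) : softNorm x ≤ ‖x‖ := by
  nlinarith [one_add_softNorm_sq x, softNorm_nonneg x, norm_nonneg x]

theorem norm_le_one_add_softNorm (x : V) : ‖x‖ ≤ 1 + softNorm x :=
  le_of_sq_le_sq (by linarith [one_add_softNorm_sq x]) (by linarith [softNorm_nonneg x])

theorem lipschitzWith_softNorm : LipschitzWith 1 (softNorm : V → ℝ) := by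
  refine LipschitzWith.of_le_add fun x y => ?_
  rw [dist_eq_norm]
  have hx : ‖x‖ ≤ ‖y‖ + ‖x - y‖ := norm_le_norm_add_norm_sub' x y
  nlinarith [one_add_softNorm_sq x, one_add_softNorm_sq y, softNorm_nonneg x, softNorm_nonneg y,
    norm_nonneg x, norm_nonneg y, norm_nonneg (x - y), norm_le_one_add_softNorm y,
    mul_le_mul_of_nonneg_left (norm_le_one_add_softNorm y) (norm_nonneg (x - y))]

theorem min_norm_le_softNorm (x : V) : min ‖x‖ (‖x‖ ^ 2) ≤ 3 * softNorm x := by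
  have hsq := one_add_softNorm_sq x
  have hq := softNorm_nonneg x
  rcases le_total ‖x‖ 1 with hx | hx
  · exact (min_le_right _ _).trans (by nlinarith [softNorm_le_norm x])
  · exact (min_le_left _ _).trans (by nlinarith)

theorem softNorm_le_sq_mul {c : ℝ} (hc : 1 ≤ c) {x : V} {y : W} (h : ‖y‖ ≤ c * ‖x‖) :
    softNorm y ≤ c ^ 2 * softNorm x := by
  have hsq : ‖y‖ ^ 2 ≤ c ^ 2 * ‖x‖ ^ 2 := by
    rw [← mul_pow]
    gcongr
  have hcq : c ^ 2 * softNorm x ^ 2 ≤ (c ^ 2 * softNorm x) ^ 2 := by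
    rw [mul_pow]
    gcongr
    exact le_self_pow₀ hc two_ne_zero
  nlinarith [one_add_softNorm_sq x, one_add_softNorm_sq y, softNorm_nonneg y,
    mul_nonneg (sq_nonneg c) (softNorm_nonneg x)]

theorem one_sub_norm_mul_le (x y : V) :
    (1 - ‖x‖) * ((1 + softNorm x) ^ 2 * (1 + softNorm (x + y))) ≤ 2 + softNorm y := by
  have hy := softNorm_nonneg y
  rcases le_total 1 ‖x‖ with hx | hx
  · exact (mul_nonpos_of_nonpos_of_nonneg (sub_nonpos.2 hx)
      (mul_nonneg (sq_nonneg _) (by linarith [softNorm_nonneg (x + y)]))).trans (by linarith)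
  have hxy : softNorm (x + y) ≤ softNorm y + ‖x‖ := by
    simpa using lipschitzWith_softNorm.le_add_mul (x + y) y
  calc (1 - ‖x‖) * ((1 + softNorm x) ^ 2 * (1 + softNorm (x + y)))
      ≤ (1 - ‖x‖) * ((1 + ‖x‖ ^ 2) * ((1 + ‖x‖) * (1 + softNorm y))) := by
        rw [one_add_softNorm_sq]
        gcongr
        linarith [mul_nonneg (norm_nonneg x) hy]
    _ = (1 - ‖x‖ ^ 4) * (1 + softNorm y) := by ring
    _ ≤ 1 * (1 + softNorm y) := by
        gcongr
        linarith [pow_nonneg (norm_nonneg x) 4]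
    _ ≤ 2 + softNorm y := by linarith

end SoftNorm

section InnerProductSpace

open scoped RealInnerProductSpace

variable {V : Type*} [NormedAddCommGroup V] [InnerProductSpace ℝ V]

theorem sq_one_add_inner_add_norm_sq_le (x y : V) :
    (1 + ⟪x, x + y⟫) ^ 2 + ‖y‖ ^ 2 ≤ ((1 + softNorm x) * (1 + softNorm (x + y))) ^ 2 := by
  rw [mul_pow, one_add_softNorm_sq, one_add_softNorm_sq, norm_add_sq_real, inner_add_right,
    real_inner_self_eq_norm_sq]
  nlinarith [real_inner_mul_inner_self_le x y, real_inner_self_eq_norm_sq x,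
    real_inner_self_eq_norm_sq y]

-- The linear term is the derivative of `softNorm` at `x`.
theorem softNorm_add_inner_add_le (x y : V) :
    softNorm x + (1 + softNorm x)⁻¹ * ⟪x, y⟫ + (1 - ‖x‖) / 2 * softNorm y ≤ softNorm (x + y) := by
  set A := 1 + softNorm x with hA
  set B := 1 + softNorm (x + y) with hB
  have hApos : 0 < A := by linarith [softNorm_nonneg x]
  have hABpos : 0 < A * B := mul_pos hApos (by linarith [softNorm_nonneg (x + y)])
  have hxy : 1 + ⟪x, x + y⟫ = A ^ 2 + ⟪x, y⟫ := by
    rw [one_add_softNorm_sq, inner_add_right, real_inner_self_eq_norm_sq, add_assoc]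
  have hcs := sq_one_add_inner_add_norm_sq_le x y
  rw [hxy, ← hA, ← hB] at hcs
  have hP : A ^ 2 + ⟪x, y⟫ ≤ A * B :=
    le_of_sq_le_sq (by linarith [sq_nonneg ‖y‖]) hABpos.le
  have hgap : A * ((1 - ‖x‖) * softNorm y) ≤ 2 * (A * B - (A ^ 2 + ⟪x, y⟫)) := by
    refine le_of_mul_le_mul_left ?_ hABpos
    calc A * B * (A * ((1 - ‖x‖) * softNorm y))
        = (1 - ‖x‖) * (A ^ 2 * B) * softNorm y := by ring
      _ ≤ (2 + softNorm y) * softNorm y := by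
          gcongr
          exacts [softNorm_nonneg y, one_sub_norm_mul_le x y]
      _ = ‖y‖ ^ 2 := by linarith [one_add_softNorm_sq y]
      _ ≤ A * B * (2 * (A * B - (A ^ 2 + ⟪x, y⟫))) := by nlinarith
  refine le_of_mul_le_mul_left ?_ hApos
  calc A * (softNorm x + A⁻¹ * ⟪x, y⟫ + (1 - ‖x‖) / 2 * softNorm y)
      = A * softNorm x + ⟪x, y⟫ + A * ((1 - ‖x‖) * softNorm y) / 2 := by
        field_simp
    _ ≤ A * softNorm (x + y) := by
        rw [hA, hB] at *
        linarith

end InnerProductSpace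

namespace SublinearExpectationSpace

variable {Ω : Type*} {S : SublinearExpectationSpace Ω} {V : Type*} [NormedAddCommGroup V]

section Moments

variable [NormedSpace ℝ V] {X : ℝ≥0 → Ω → V} {ε s : ℝ≥0} {B : ℝ}

theorem IsLevy.E_clm_add (hX : S.IsLevy X) (l : V →L[ℝ] ℝ) (t s : ℝ≥0) :
    S.E (fun ω => l (X (t + s) ω)) = S.E (fun ω => l (X t ω)) + S.E fun ω => l (X s ω) := by
  have htrans (x : V) : S.transition (X s) l x = l x + S.E fun ω => l (X s ω) := by
    simp only [transition, map_add, add_comm (l x)]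
    exact S.E_add_const (hX.mem s l) (l x)
  simp only [hX.E_comp_add t s ⟨_, l.lipschitz⟩, htrans]
  exact S.E_add_const (hX.mem t l) _

variable [FiniteDimensional ℝ V]

theorem IsRandomVector.norm_mem {Y : Ω → V} (hY : S.IsRandomVector Y) : (fun ω => ‖Y ω‖) ∈ S.H :=
  hY.lip_mem IsLip.norm

theorem IsRandomVector.softNorm_mem {Y : Ω → V} (hY : S.IsRandomVector Y) :
    (fun ω => softNorm (Y ω)) ∈ S.H :=
  hY.lip_mem ⟨1, lipschitzWith_softNorm⟩

theorem IsLevy.E_clm_le (hX : S.IsLevy X) (hB : ∀ t ≤ ε, S.E (fun ω => ‖X t ω‖) ≤ B)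
    (l : V →L[ℝ] ℝ) (hs : s ≤ ε) : S.E (fun ω => l (X s ω)) ≤ 2 * B / ε * ‖l‖ * s := by
  have hle (t : ℝ≥0) (ht : t ≤ ε) : S.E (fun ω => l (X t ω)) ≤ ‖l‖ * B :=
    calc S.E (fun ω => l (X t ω))
        ≤ S.E (fun ω => ‖l‖ * ‖X t ω‖) :=
          S.E_mono (hX.mem t l) (S.const_mul_mem (hX.mem t).norm_mem _)
            fun ω => (le_abs_self _).trans (l.le_opNorm _)
      _ = ‖l‖ * S.E (fun ω => ‖X t ω‖) := S.E_const_mul (hX.mem t).norm_mem (norm_nonneg l)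
      _ ≤ ‖l‖ * B := mul_le_mul_of_nonneg_left (hB t ht) (norm_nonneg l)
  have h0 : S.E (fun ω => l (X 0 ω)) = 0 := by simp only [hX.zero, map_zero, S.const]
  calc S.E (fun ω => l (X s ω))
      ≤ (0 + 2 * (‖l‖ * B) / ε) / 1 * s :=
        le_mul_of_almost_superadditive (a := fun t => S.E fun ω => l (X t ω)) one_pos h0 hle
          (fun t s _ => by rw [hX.E_clm_add]; linarith) hs
    _ = 2 * B / ε * ‖l‖ * s := by ring

theorem IsLevy.exists_abs_E_clm_le (hX : S.IsLevy X)
    (hX0 : Tendsto (fun t => S.E fun ω => ‖X t ω‖) (𝓝 0) (𝓝 0)) :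
    ∃ C ≥ 0, ∀ᶠ s in 𝓝 (0 : ℝ≥0), ∀ l : V →L[ℝ] ℝ,
      |S.E fun ω => l (X s ω)| ≤ C * ‖l‖ * s := by
  obtain ⟨ε, hε, hB⟩ := nhds_bot_basis_Iic.eventually_iff.1 (hX0.eventually_le_const one_pos)
  refine ⟨2 * 1 / ε, by positivity, ?_⟩
  filter_upwards [Iic_mem_nhds hε] with s hs l
  have hle (l : V →L[ℝ] ℝ) := hX.E_clm_le (fun t ht => hB ht) l hs
  refine abs_le'.2 ⟨hle l, ?_⟩
  have hneg : -S.E (fun ω => l (X s ω)) ≤ S.E fun ω => (-l) (X s ω) := by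
    simpa only [neg_apply, neg_neg] using S.neg_E_neg_le (hX.mem s (-l))
  exact hneg.trans (norm_neg l ▸ hle (-l))

end Moments

section EuclideanMoments

variable [InnerProductSpace ℝ V] [FiniteDimensional ℝ V]

theorem IsRandomVector.softNorm_add_le_transition {Y : Ω → V} (hY : S.IsRandomVector Y) {K : ℝ}
    (hK : ∀ l : V →L[ℝ] ℝ, ‖l‖ ≤ 1 → S.E (fun ω => l (Y ω)) ≤ K) (x : V) :
    softNorm x + (1 - ‖x‖) / 2 * S.E (fun ω => softNorm (Y ω)) - K ≤
      S.transition Y softNorm x := by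
  let l : V →L[ℝ] ℝ := -((1 + softNorm x)⁻¹ • innerSL ℝ x)
  have hl : ‖l‖ ≤ 1 := by
    have hpos : 0 < 1 + softNorm x := by linarith [softNorm_nonneg x]
    rw [norm_neg, norm_smul, innerSL_apply_norm, norm_inv, Real.norm_of_nonneg hpos.le,
      inv_mul_le_one₀ hpos]
    exact norm_le_one_add_softNorm x
  have htransmem : (fun ω => softNorm (x + Y ω)) ∈ S.H :=
    hY.lip_mem (IsLip.comp_const_add ⟨1, lipschitzWith_softNorm⟩ x)
  have hqmem : (fun ω => (1 - ‖x‖) / 2 * softNorm (Y ω)) ∈ S.H :=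
    S.const_mul_mem hY.softNorm_mem _
  calc softNorm x + (1 - ‖x‖) / 2 * S.E (fun ω => softNorm (Y ω)) - K
      ≤ S.E (fun ω => (1 - ‖x‖) / 2 * softNorm (Y ω)) + softNorm x - K := by
        linarith [S.mul_E_le hY.softNorm_mem ((1 - ‖x‖) / 2)]
    _ = S.E (fun ω => (1 - ‖x‖) / 2 * softNorm (Y ω) + softNorm x) - K := by
        rw [S.E_add_const hqmem]
    _ ≤ S.E (fun ω => softNorm (x + Y ω) + l (Y ω)) - K := by
        gcongr
        refine S.E_mono (S.H.add_mem hqmem (S.const_mem _)) (S.H.add_mem htransmem (hY l))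
          fun ω => ?_
        have := softNorm_add_inner_add_le x (Y ω)
        simp only [l, neg_apply, smul_apply,
          innerSL_apply_apply, smul_eq_mul]
        linarith
    _ ≤ S.transition Y softNorm x :=
        sub_le_iff_le_add.2
          ((S.E_add_le htransmem (hY l)).trans (add_le_add le_rfl (hK l hl)))

variable {X : ℝ≥0 → Ω → V} {ε s : ℝ≥0}

theorem IsLevy.E_softNorm_add_le (hX : S.IsLevy X)
    (hε : ∀ t ≤ ε, S.E (fun ω => ‖X t ω‖) ≤ 1 / 2) {t : ℝ≥0} (ht : t ≤ ε) (hs : s ≤ ε) :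
    S.E (fun ω => softNorm (X t ω)) + 1 / 4 * S.E (fun ω => softNorm (X s ω)) - 1 / ε * s ≤
      S.E fun ω => softNorm (X (t + s) ω) := by
  set m := S.E fun ω => softNorm (X s ω)
  have hlip : LipschitzWith 1 (softNorm : V → ℝ) := lipschitzWith_softNorm
  have hm : 0 ≤ m := S.E_nonneg (hX.mem s).softNorm_mem fun ω => softNorm_nonneg _
  have hK (l : V →L[ℝ] ℝ) (hl : ‖l‖ ≤ 1) : S.E (fun ω => l (X s ω)) ≤ 1 / ε * s := by
    calc S.E (fun ω => l (X s ω)) ≤ 2 * (1 / 2) / ε * ‖l‖ * s := hX.E_clm_le hε l hs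
      _ ≤ 2 * (1 / 2) / ε * 1 * s := by gcongr
      _ = 1 / ε * s := by ring
  have htransmem : (fun ω => S.transition (X s) softNorm (X t ω)) ∈ S.H :=
    (hX.mem t).lip_mem ⟨1, (hX.mem s).lipschitzWith_transition hlip⟩
  have hnmem : (fun ω => m / 2 * ‖X t ω‖) ∈ S.H := S.const_mul_mem (hX.mem t).norm_mem _
  rw [hX.E_comp_add t s ⟨1, hlip⟩]
  have hmono : S.E (fun ω => softNorm (X t ω) + (m / 2 - 1 / ε * s)) ≤
      S.E fun ω => S.transition (X s) softNorm (X t ω) + m / 2 * ‖X t ω‖ :=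
    S.E_mono (S.H.add_mem (hX.mem t).softNorm_mem (S.const_mem _)) (S.H.add_mem htransmem hnmem)
      fun ω => by linarith [(hX.mem s).softNorm_add_le_transition hK (X t ω)]
  rw [S.E_add_const (hX.mem t).softNorm_mem] at hmono
  have hsub := S.E_add_le htransmem hnmem
  rw [S.E_const_mul (hX.mem t).norm_mem (by positivity)] at hsub
  linarith [mul_le_mul_of_nonneg_left (hε t ht) hm]

theorem IsLevy.E_softNorm_le (hX : S.IsLevy X) (hε : ∀ t ≤ ε, S.E (fun ω => ‖X t ω‖) ≤ 1 / 2)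
    (hs : s ≤ ε) : S.E (fun ω => softNorm (X s ω)) ≤ 8 / ε * s := by
  have h0 : S.E (fun ω => softNorm (X 0 ω)) = 0 := by
    simp only [hX.zero, softNorm_zero, S.const]
  calc S.E (fun ω => softNorm (X s ω))
      ≤ (1 / ε + 2 * (1 / 2) / ε) / (1 / 4) * s :=
        le_mul_of_almost_superadditive (a := fun t => S.E fun ω => softNorm (X t ω)) (by norm_num)
          h0 (fun t ht => (S.E_mono (hX.mem t).softNorm_mem (hX.mem t).norm_mem
            fun ω => softNorm_le_norm _).trans (hε t ht))
          (fun t s hts => hX.E_softNorm_add_le hε (le_self_add.trans hts)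
            (le_add_self.trans hts)) hs
    _ = 8 / ε * s := by ring

end EuclideanMoments

theorem IsLevy.exists_E_softNorm_le [NormedSpace ℝ V] [FiniteDimensional ℝ V] {X : ℝ≥0 → Ω → V}
    (hX : S.IsLevy X) (hX0 : Tendsto (fun t => S.E fun ω => ‖X t ω‖) (𝓝 0) (𝓝 0)) :
    ∃ C ≥ 0, ∀ᶠ s in 𝓝 (0 : ℝ≥0), S.E (fun ω => softNorm (X s ω)) ≤ C * s := by
  let e := toEuclidean (E := V)
  have hY := hX.map e.toContinuousLinearMap
  have hYle (t : ℝ≥0) :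
      S.E (fun ω => ‖e (X t ω)‖) ≤ ‖e.toContinuousLinearMap‖ * S.E fun ω => ‖X t ω‖ := by
    rw [← S.E_const_mul (hX.mem t).norm_mem (norm_nonneg _)]
    exact S.E_mono (hY.mem t).norm_mem (S.const_mul_mem (hX.mem t).norm_mem _)
      fun ω => e.toContinuousLinearMap.le_opNorm _
  have hsmall : ∀ᶠ t in 𝓝 0, S.E (fun ω => ‖e (X t ω)‖) ≤ 1 / 2 :=
    ((hX0.const_mul _).eventually_le_const (by norm_num)).mono fun t ht => (hYle t).trans ht
  obtain ⟨ε, hε, hle⟩ := nhds_bot_basis_Iic.eventually_iff.1 hsmall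
  let c := max 1 ‖e.symm.toContinuousLinearMap‖
  refine ⟨c ^ 2 * (8 / ε), by positivity, ?_⟩
  filter_upwards [Iic_mem_nhds hε] with s hs
  calc S.E (fun ω => softNorm (X s ω))
      ≤ S.E (fun ω => c ^ 2 * softNorm (e (X s ω))) :=
        S.E_mono (hX.mem s).softNorm_mem (S.const_mul_mem (hY.mem s).softNorm_mem _) fun ω =>
          softNorm_le_sq_mul (le_max_left _ _) <| by
            simpa using e.symm.toContinuousLinearMap.le_of_opNorm_le (le_max_right 1 _) (e (X s ω))
    _ = c ^ 2 * S.E (fun ω => softNorm (e (X s ω))) :=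
        S.E_const_mul (hY.mem s).softNorm_mem (sq_nonneg c)
    _ ≤ c ^ 2 * (8 / ε * s) := by
        gcongr
        exact hY.E_softNorm_le (fun t ht => hle ht) hs
    _ = c ^ 2 * (8 / ε) * s := by ring

end SublinearExpectationSpace

section Calculus

variable {V W : Type*} [NormedAddCommGroup V] [NormedSpace ℝ V] [NormedAddCommGroup W]
  [NormedSpace ℝ W] {f : V → ℝ} {L : ℝ≥0}

/-- `f` is a Lipschitz function with Lipschitz derivative, and `L` is a Lipschitz constant of both:
the size of `f` that controls the small-time moments of a Lévy process. -/
structure IsC11With (L : ℝ≥0) (f : V → ℝ) : Prop where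
  differentiable : Differentiable ℝ f
  lipschitzWith : LipschitzWith L f
  lipschitzWith_fderiv : LipschitzWith L (fderiv ℝ f)

theorem IsC11With.norm_fderiv_le (hf : IsC11With L f) (x : V) : ‖fderiv ℝ f x‖ ≤ L :=
  norm_fderiv_le_of_lipschitz ℝ hf.lipschitzWith

theorem IsC11With.abs_sub_sub_fderiv_le (hf : IsC11With L f) (y : V) :
    |f y - f 0 - fderiv ℝ f 0 y| ≤ 6 * L * softNorm y := by
  have hlin : |f y - f 0 - fderiv ℝ f 0 y| ≤ 2 * L * ‖y‖ := by
    have hf0 : |f y - f 0| ≤ L * ‖y‖ := by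
      simpa only [Real.dist_eq, dist_zero_right] using hf.lipschitzWith.dist_le_mul y 0
    have hder : |fderiv ℝ f 0 y| ≤ L * ‖y‖ :=
      (fderiv ℝ f 0).le_of_opNorm_le (hf.norm_fderiv_le 0) y
    linarith [abs_sub (f y - f 0) (fderiv ℝ f 0 y)]
  have hquad : |f y - f 0 - fderiv ℝ f 0 y| ≤ 2 * L * ‖y‖ ^ 2 := by
    have hder : ∀ x ∈ Metric.closedBall (0 : V) ‖y‖, ‖fderiv ℝ f x - fderiv ℝ f 0‖ ≤ L * ‖y‖ :=
      fun x hx => by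
        rw [← dist_eq_norm]
        exact (hf.lipschitzWith_fderiv.dist_le_mul x 0).trans
          (mul_le_mul_of_nonneg_left hx L.coe_nonneg)
    have hmv := (convex_closedBall (0 : V) ‖y‖).norm_image_sub_le_of_norm_fderiv_le'
      (fun x _ => hf.differentiable x) hder (Metric.mem_closedBall_self (norm_nonneg y))
      (mem_closedBall_zero_iff.2 le_rfl)
    rw [sub_zero, Real.norm_eq_abs] at hmv
    linarith [mul_nonneg L.coe_nonneg (sq_nonneg ‖y‖)]
  calc |f y - f 0 - fderiv ℝ f 0 y|
      ≤ 2 * L * min ‖y‖ (‖y‖ ^ 2) := by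
        rw [mul_min_of_nonneg _ _ (by positivity)]
        exact le_min hlin hquad
    _ ≤ 2 * L * (3 * softNorm y) := by
        gcongr
        exact min_norm_le_softNorm y
    _ = 6 * L * softNorm y := by ring

theorem lipschitzWith_comp_const_add_sub {F : V → W} (hF : Differentiable ℝ F)
    (hF' : LipschitzWith L (fderiv ℝ F)) (x : V) :
    LipschitzWith (L * ‖x‖₊) fun y => F (x + y) - F y := by
  have hshift : Differentiable ℝ fun y => F (x + y) := hF.comp (differentiable_id.const_add x)
  refine lipschitzWith_of_nnnorm_fderiv_le (𝕜 := ℝ) (hshift.sub hF) fun y => ?_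
  rw [fderiv_fun_sub (hshift y) (hF y), fderiv_comp_add_left]
  simpa only [nndist_eq_nnnorm, add_sub_cancel_right] using hF'.nndist_le (x + y) y

theorem IsCb.exists_norm_iteratedFDeriv_le {k : ℕ} (hf : IsCb k f) :
    ∃ M : ℝ≥0, ∀ j ≤ k, ∀ x, ‖iteratedFDeriv ℝ j f x‖ ≤ M := by
  choose! M hM using hf.2
  refine ⟨(Finset.range (k + 1)).sup fun j => (M j).toNNReal, fun j hj x => ?_⟩
  exact (hM j hj x).trans ((Real.le_coe_toNNReal _).trans (NNReal.coe_le_coe.2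
    (Finset.le_sup (f := fun j => (M j).toNNReal) (Finset.mem_range_succ_iff.2 hj))))

set_option maxSynthPendingDepth 3 in
theorem IsCb.exists_isC11With (hf : IsCb 3 f) :
    ∃ M : ℝ≥0, IsC11With M f ∧ ∀ x, IsC11With (M * ‖x‖₊) fun y => f (x + y) - f y := by
  obtain ⟨M, hM⟩ := hf.exists_norm_iteratedFDeriv_le
  have hf' : ContDiff ℝ 2 (fderiv ℝ f) := hf.1.fderiv_right (by norm_num)
  have hf'' : ContDiff ℝ 1 (fderiv ℝ (fderiv ℝ f)) := hf'.fderiv_right (by norm_num)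
  have hd : Differentiable ℝ f := hf.1.differentiable (by norm_num)
  have hd' : Differentiable ℝ (fderiv ℝ f) := hf'.differentiable (by norm_num)
  have hlip : LipschitzWith M f := lipschitzWith_of_nnnorm_fderiv_le (𝕜 := ℝ) hd fun x => by
    rw [← NNReal.coe_le_coe, coe_nnnorm, ← norm_iteratedFDeriv_one]
    exact hM 1 (by norm_num) x
  have hlip' : LipschitzWith M (fderiv ℝ f) :=
    lipschitzWith_of_nnnorm_fderiv_le (𝕜 := ℝ) hd' fun x => by
      rw [← NNReal.coe_le_coe, coe_nnnorm, ← norm_iteratedFDeriv_one, norm_iteratedFDeriv_fderiv]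
      exact hM 2 (by norm_num) x
  have hlip'' : LipschitzWith M (fderiv ℝ (fderiv ℝ f)) :=
    lipschitzWith_of_nnnorm_fderiv_le (𝕜 := ℝ) (hf''.differentiable (by norm_num)) fun x => by
      rw [← NNReal.coe_le_coe, coe_nnnorm, ← norm_iteratedFDeriv_one, norm_iteratedFDeriv_fderiv,
        norm_iteratedFDeriv_fderiv]
      exact hM 3 le_rfl x
  refine ⟨M, ⟨hd, hlip, hlip'⟩, fun x => ?_⟩
  have hshift : Differentiable ℝ fun y => f (x + y) := hd.comp (differentiable_id.const_add x)
  refine ⟨hshift.sub hd, lipschitzWith_comp_const_add_sub hd hlip' x, ?_⟩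
  have hfderiv : fderiv ℝ (fun y => f (x + y) - f y) =
      fun y => fderiv ℝ f (x + y) - fderiv ℝ f y := by
    ext1 y
    rw [fderiv_fun_sub (hshift y) (hd y), fderiv_comp_add_left]
  rw [hfderiv]
  exact lipschitzWith_comp_const_add_sub hd' hlip'' x

end Calculus

namespace SublinearExpectationSpace

section SmallTime

variable {Ω : Type*} {S : SublinearExpectationSpace Ω} {V : Type*} [NormedAddCommGroup V]
  [NormedSpace ℝ V] [FiniteDimensional ℝ V] {X : ℝ≥0 → Ω → V}

theorem IsLevy.exists_abs_E_sub_le (hX : S.IsLevy X)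
    (hX0 : Tendsto (fun t => S.E fun ω => ‖X t ω‖) (𝓝 0) (𝓝 0)) :
    ∃ C ≥ 0, ∀ᶠ s in 𝓝 (0 : ℝ≥0), ∀ L g, IsC11With L g →
      |S.E (fun ω => g (X s ω)) - g 0| ≤ C * L * s := by
  obtain ⟨C₁, hC₁, hlin⟩ := hX.exists_abs_E_clm_le hX0
  obtain ⟨C₂, hC₂, hsoft⟩ := hX.exists_E_softNorm_le hX0
  refine ⟨C₁ + 6 * C₂, by positivity, ?_⟩
  filter_upwards [hlin, hsoft] with s hlin hsoft L g hg
  set l := fderiv ℝ g 0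
  have hl : |S.E fun ω => l (X s ω)| ≤ C₁ * L * s :=
    (hlin l).trans (by gcongr; exact hg.norm_fderiv_le 0)
  have hrem : |S.E (fun ω => g (X s ω)) - S.E (fun ω => l (X s ω) + g 0)| ≤ 6 * C₂ * L * s :=
    calc |S.E (fun ω => g (X s ω)) - S.E (fun ω => l (X s ω) + g 0)|
        ≤ S.E (fun ω => 6 * L * softNorm (X s ω)) :=
          S.abs_E_sub_le ((hX.mem s).lip_mem ⟨L, hg.lipschitzWith⟩)
            (S.H.add_mem (hX.mem s l) (S.const_mem _))
            (S.const_mul_mem (hX.mem s).softNorm_mem _) fun ω => by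
              simpa only [sub_sub, add_comm (g 0)] using hg.abs_sub_sub_fderiv_le (X s ω)
      _ = 6 * L * S.E (fun ω => softNorm (X s ω)) :=
          S.E_const_mul (hX.mem s).softNorm_mem (by positivity)
      _ ≤ 6 * L * (C₂ * s) := by gcongr
      _ = 6 * C₂ * L * s := by ring
  rw [S.E_add_const (hX.mem s l)] at hrem
  calc |S.E (fun ω => g (X s ω)) - g 0|
      = |(S.E (fun ω => g (X s ω)) - (S.E (fun ω => l (X s ω)) + g 0)) +
          S.E fun ω => l (X s ω)| := by ring_nf
    _ ≤ 6 * C₂ * L * s + C₁ * L * s := (abs_add_le _ _).trans (add_le_add hrem hl)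
    _ = (C₁ + 6 * C₂) * L * s := by ring

theorem IsLevy.E_comp_add_le (hX : S.IsLevy X) {f : V → ℝ} (hf : IsLip f) {D : ℝ} (hD : 0 ≤ D)
    {s : ℝ≥0} (h : ∀ x, S.transition (X s) f x ≤ f x + S.E (fun ω => f (X s ω)) + D * ‖x‖)
    (t : ℝ≥0) :
    S.E (fun ω => f (X (t + s) ω)) ≤
      S.E (fun ω => f (X t ω)) + S.E (fun ω => f (X s ω)) + D * S.E fun ω => ‖X t ω‖ := by
  have hfmem : (fun ω => f (X t ω)) ∈ S.H := (hX.mem t).lip_mem hf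
  have hfcmem : (fun ω => f (X t ω) + S.E (fun ω => f (X s ω))) ∈ S.H :=
    S.H.add_mem hfmem (S.const_mem _)
  have hnmem : (fun ω => D * ‖X t ω‖) ∈ S.H := S.const_mul_mem (hX.mem t).norm_mem D
  have htransmem : (fun ω => S.transition (X s) f (X t ω)) ∈ S.H :=
    let ⟨K, hK⟩ := hf
    (hX.mem t).lip_mem ⟨K, (hX.mem s).lipschitzWith_transition hK⟩
  calc S.E (fun ω => f (X (t + s) ω))
      = S.E (fun ω => S.transition (X s) f (X t ω)) := hX.E_comp_add t s hf
    _ ≤ S.E (fun ω => f (X t ω) + S.E (fun ω => f (X s ω)) + D * ‖X t ω‖) :=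
        S.E_mono htransmem (S.H.add_mem hfcmem hnmem) fun ω => h (X t ω)
    _ ≤ S.E (fun ω => f (X t ω) + S.E (fun ω => f (X s ω))) + S.E (fun ω => D * ‖X t ω‖) :=
        S.E_add_le hfcmem hnmem
    _ = S.E (fun ω => f (X t ω)) + S.E (fun ω => f (X s ω)) + D * S.E fun ω => ‖X t ω‖ := by
        rw [S.E_add_const hfmem, S.E_const_mul (hX.mem t).norm_mem hD]

theorem IsLevy.tendsto_generator (hX : S.IsLevy X)
    (hX0 : Tendsto (fun t => S.E fun ω => ‖X t ω‖) (𝓝 0) (𝓝 0)) {f : V → ℝ} (hf : IsCb 3 f)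
    (hf0 : f 0 = 0) :
    Tendsto (fun δ : ℝ≥0 => S.E (fun ω => f (X δ ω)) / (δ : ℝ)) (𝓝[>] 0)
      (𝓝 (S.generator X f)) := by
  obtain ⟨C, hC, hmoment⟩ := hX.exists_abs_E_sub_le hX0
  obtain ⟨M, hfM, hshift⟩ := hf.exists_isC11With
  have hflip : IsLip f := ⟨M, hfM.lipschitzWith⟩
  have htrans {s : ℝ≥0} (hs : ∀ L g, IsC11With L g →
      |S.E (fun ω => g (X s ω)) - g 0| ≤ C * L * s) (x : V) :
      S.transition (X s) f x ≤ f x + S.E (fun ω => f (X s ω)) + C * M * s * ‖x‖ := by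
    have hsub := S.subadd _ ((hX.mem s).lip_mem (hflip.comp_const_add x)) _
      ((hX.mem s).lip_mem hflip)
    have hinc := le_of_abs_le (hs _ _ (hshift x))
    simp only [add_zero, hf0, sub_zero, NNReal.coe_mul, coe_nnnorm] at hinc
    change S.transition (X s) f x - _ ≤ S.E fun ω => f (x + X s ω) - f (X s ω) at hsub
    linarith
  refine tendsto_nhds_limUnder (exists_tendsto_div_of_almost_subadditive (C := C * M)
    (hmoment.mono fun t ht => ?_) fun η hη => ?_)
  · simpa only [hf0, sub_zero] using ht M f hfM
  have hsmall : ∀ᶠ t in 𝓝 0, C * M * S.E (fun ω => ‖X t ω‖) ≤ η :=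
    (hX0.const_mul (C * M : ℝ)).eventually_le_const (by simpa using hη)
  obtain ⟨ε, hε, hle⟩ := nhds_bot_basis_Iic.eventually_iff.1 (hsmall.and hmoment)
  refine ⟨ε, hε, fun t s hts => ?_⟩
  have hadd := hX.E_comp_add_le hflip (D := C * M * s) (by positivity)
    (htrans (hle (le_add_self.trans hts)).2) t
  linarith [mul_le_mul_of_nonneg_right (hle (le_self_add.trans hts)).1 s.coe_nonneg]

end SmallTime

section Regularity

variable {Ω : Type*} {S : SublinearExpectationSpace Ω} {V : Type*} [NormedAddCommGroup V]
  [NormedSpace ℝ V] [FiniteDimensional ℝ V] {φ : V → ℝ} {K : ℝ≥0}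

theorem IsRandomVector.abs_transition_sub_le {Y : Ω → V} (hY : S.IsRandomVector Y)
    (hφ : LipschitzWith K φ) (x : V) :
    |S.transition Y φ x - φ x| ≤ K * S.E fun ω => ‖Y ω‖ := by
  rw [← S.const (φ x), ← S.E_const_mul hY.norm_mem K.coe_nonneg]
  refine S.abs_E_sub_le (hY.lip_mem (IsLip.comp_const_add ⟨K, hφ⟩ x)) (S.const_mem _)
    (S.const_mul_mem hY.norm_mem _) fun ω => ?_
  simpa only [Real.dist_eq, dist_self_add_left] using hφ.dist_le_mul (x + Y ω) x

theorem IsLevy.dist_transition_le {X : ℝ≥0 → Ω → V} (hX : S.IsLevy X) (hφ : LipschitzWith K φ)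
    (t t' : ℝ≥0) (x : V) :
    dist (S.transition (X t) φ x) (S.transition (X t') φ x) ≤
      K * S.E fun ω => ‖X (nndist t t') ω‖ := by
  wlog h : t ≤ t' generalizing t t'
  · rw [dist_comm, nndist_comm]
    exact this t' t (le_of_not_ge h)
  obtain ⟨δ, rfl⟩ := exists_add_of_le h
  have hδ : nndist t (t + δ) = δ := by
    rw [NNReal.nndist_eq, tsub_eq_zero_of_le le_self_add, add_tsub_cancel_left,
      max_eq_right zero_le]
  rw [hδ, dist_comm, add_comm, hX.transition_add δ t ⟨K, hφ⟩]
  exact (hX.mem δ).abs_transition_sub_le ((hX.mem t).lipschitzWith_transition hφ) x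

theorem IsLevy.continuous_transition {X : ℝ≥0 → Ω → V} (hX : S.IsLevy X)
    (hX0 : Tendsto (fun t => S.E fun ω => ‖X t ω‖) (𝓝 0) (𝓝 0)) (hφ : IsLip φ) :
    Continuous fun p : ℝ≥0 × V => S.transition (X p.1) φ p.2 := by
  obtain ⟨K, hK⟩ := hφ
  refine continuous_iff_continuousAt.2 fun p₀ => tendsto_iff_dist_tendsto_zero.2 ?_
  have hbound (p : ℝ≥0 × V) :
      dist (S.transition (X p.1) φ p.2) (S.transition (X p₀.1) φ p₀.2) ≤
        K * dist p.2 p₀.2 + K * S.E fun ω => ‖X (nndist p.1 p₀.1) ω‖ :=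
    (dist_triangle _ (S.transition (X p.1) φ p₀.2) _).trans
      (add_le_add (((hX.mem _).lipschitzWith_transition hK).dist_le_mul _ _)
        (hX.dist_transition_le hK _ _ _))
  refine squeeze_zero (fun _ => dist_nonneg) hbound ?_
  have hspace : Tendsto (fun p : ℝ≥0 × V => (K : ℝ) * dist p.2 p₀.2) (𝓝 p₀) (𝓝 0) :=
    Continuous.tendsto' (by fun_prop) _ _ (by simp)
  have htime : Tendsto (fun p : ℝ≥0 × V => nndist p.1 p₀.1) (𝓝 p₀) (𝓝 0) :=
    Continuous.tendsto' (by fun_prop) _ _ (by simp)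
  simpa using hspace.add ((hX0.comp htime).const_mul (K : ℝ))

end Regularity

end SublinearExpectationSpace

section TestFunctions

theorem exists_abs_sub_le_add_mul_dist {E : Type*} [PseudoMetricSpace E] {h : E → ℝ} {s : Set E}
    {p₀ : E} (hp₀ : p₀ ∈ s) {M : ℝ} (hM : ∀ p ∈ s, |h p| ≤ M) (hc : ContinuousWithinAt h s p₀)
    {ε : ℝ} (hε : 0 < ε) : ∃ K ≥ 0, ∀ p ∈ s, |h p - h p₀| ≤ ε + K * dist p p₀ := by
  obtain ⟨ρ, hρ, hnear⟩ := Metric.continuousWithinAt_iff.1 hc ε hε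
  have hM0 : 0 ≤ M := (abs_nonneg _).trans (hM p₀ hp₀)
  refine ⟨2 * M / ρ, by positivity, fun p hp => ?_⟩
  rcases lt_or_ge (dist p p₀) ρ with hd | hd
  · exact (hnear hp hd).le.trans (le_add_of_nonneg_right (by positivity))
  · calc |h p - h p₀| ≤ 2 * M := by linarith [abs_sub (h p) (h p₀), hM p hp, hM p₀ hp₀]
      _ = 2 * M / ρ * ρ := (div_mul_cancel₀ _ hρ.ne').symm
      _ ≤ 2 * M / ρ * dist p p₀ := by gcongr
      _ ≤ ε + 2 * M / ρ * dist p p₀ := le_add_of_nonneg_left hε.le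

variable {V : Type*} [NormedAddCommGroup V] [NormedSpace ℝ V] {f : V → ℝ} {ψ : ℝ → V → ℝ}

theorem IsCb.isLip (hf : IsCb 3 f) : IsLip f :=
  let ⟨M, hM, _⟩ := hf.exists_isC11With
  ⟨M, hM.lipschitzWith⟩

theorem IsCb.comp_const_add_sub_const {k : ℕ} (hf : IsCb k f) (x : V) (c : ℝ) :
    IsCb k fun z => f (x + z) - c := by
  have hshift : ContDiff ℝ k fun z => f (x + z) := hf.1.comp (contDiff_const.add contDiff_id)
  refine ⟨hshift.sub contDiff_const, fun j hj => ?_⟩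
  obtain ⟨M, hM⟩ := hf.2 j hj
  refine ⟨M + |c|, fun z => ?_⟩
  rw [fun_iteratedFDeriv_sub_apply (hshift.of_le (Nat.cast_le.2 hj)).contDiffAt
    contDiff_const.contDiffAt, iteratedFDeriv_comp_add_left]
  refine (norm_sub_le _ _).trans (add_le_add (hM _) ?_)
  rcases eq_or_ne j 0 with rfl | hj0
  · rw [norm_iteratedFDeriv_zero, Real.norm_eq_abs]
  · rw [iteratedFDeriv_const_of_ne hj0, Pi.zero_apply, norm_zero]
    exact abs_nonneg c

theorem IsCb23.isCb (hψ : IsCb23 ψ) {t : ℝ} (ht : 0 < t) : IsCb 3 (ψ t) :=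
  ⟨hψ.contDiff_space t ht, fun j hj => (hψ.space_bdd j hj).imp fun _ hM => hM t ht⟩

theorem IsCb23.exists_abs_deriv_time_sub_le (hψ : IsCb23 ψ) {t : ℝ} (ht : 0 < t) (x : V) {ε : ℝ}
    (hε : 0 < ε) : ∃ K ≥ 0, ∀ s > 0, ∀ z,
      |deriv (fun s => ψ s z) s - deriv (fun s => ψ s x) t| ≤ ε + K * (|s - t| + ‖z - x‖) := by
  obtain ⟨M, hM⟩ := hψ.time_bdd 1 one_le_two
  have hc := hψ.time_cont 1 one_le_two
  simp only [iteratedDeriv_one] at hM hc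
  have hmem : (t, x) ∈ Set.Ioi (0 : ℝ) ×ˢ (Set.univ : Set V) := ⟨ht, trivial⟩
  obtain ⟨K, hK, hle⟩ := exists_abs_sub_le_add_mul_dist hmem (fun p hp => hM p.1 hp.1 p.2)
    (hc _ hmem) hε
  refine ⟨K, hK, fun s hs z => (hle (s, z) ⟨hs, trivial⟩).trans ?_⟩
  rw [Prod.dist_eq, Real.dist_eq, dist_eq_norm]
  gcongr
  exact max_le_add_of_nonneg (abs_nonneg _) (norm_nonneg _)

theorem IsCb23.exists_time_expansion (hψ : IsCb23 ψ) {t : ℝ} (ht : 0 < t) (x : V) {ε : ℝ}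
    (hε : 0 < ε) : ∃ K ≥ 0, ∀ δ, 0 ≤ δ → δ < t → ∀ z,
      |ψ (t - δ) z - ψ t z + δ * deriv (fun s => ψ s x) t| ≤
        δ * (ε + K * (δ + ‖z - x‖)) := by
  obtain ⟨K, hK, hderiv⟩ := hψ.exists_abs_deriv_time_sub_le ht x hε
  refine ⟨K, hK, fun δ hδ hδt z => ?_⟩
  set c := deriv (fun s => ψ s x) t
  have hdiff (s : ℝ) (hs : s ∈ Set.Icc (t - δ) t) : DifferentiableAt ℝ (fun s => ψ s z) s :=
    ((hψ.contDiff_time z).differentiableOn (by norm_num)).differentiableAt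
      (Ioi_mem_nhds ((sub_pos.2 hδt).trans_le hs.1))
  have hbound (s : ℝ) (hs : s ∈ Set.Icc (t - δ) t) :
      ‖deriv (fun s => ψ s z - s * c) s‖ ≤ ε + K * (δ + ‖z - x‖) := by
    rw [deriv_fun_sub (hdiff s hs) (by fun_prop), deriv_mul_const (by fun_prop), deriv_id'',
      one_mul, Real.norm_eq_abs]
    refine (hderiv s ((sub_pos.2 hδt).trans_le hs.1) z).trans ?_
    gcongr
    exact abs_le.2 ⟨by linarith [hs.1], by linarith [hs.2]⟩
  have hmv := (convex_Icc (t - δ) t).norm_image_sub_le_of_norm_deriv_le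
    (fun s hs => (hdiff s hs).fun_sub (by fun_prop)) hbound
    (Set.right_mem_Icc.2 (sub_le_self t hδ)) (Set.left_mem_Icc.2 (sub_le_self t hδ))
  rw [sub_sub_cancel_left, norm_neg, Real.norm_of_nonneg hδ, Real.norm_eq_abs] at hmv
  convert hmv.trans_eq (mul_comm _ _) using 2
  ring

end TestFunctions

namespace SublinearExpectationSpace

section Viscosity

variable {Ω : Type*} {S : SublinearExpectationSpace Ω} {V : Type*} [NormedAddCommGroup V]
  [NormedSpace ℝ V] [FiniteDimensional ℝ V]

theorem IsRandomVector.transition_mono {Y : Ω → V} (hY : S.IsRandomVector Y) {φ φ' : V → ℝ}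
    (hφ : IsLip φ) (hφ' : IsLip φ') (h : ∀ x, φ x ≤ φ' x) (x : V) :
    S.transition Y φ x ≤ S.transition Y φ' x :=
  S.E_mono (hY.lip_mem (hφ.comp_const_add x)) (hY.lip_mem (hφ'.comp_const_add x)) fun _ => h _

theorem IsRandomVector.abs_transition_sub_add_le {Y : Ω → V} (hY : S.IsRandomVector Y)
    {g h : V → ℝ} (hg : IsLip g) (hh : IsLip h) {x : V} {a b K : ℝ} (hK : 0 ≤ K)
    (hgh : ∀ z, |g z - h z + a| ≤ b + K * ‖z - x‖) :
    |S.transition Y g x - S.transition Y h x + a| ≤ b + K * S.E fun ω => ‖Y ω‖ := by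
  have hgmem : (fun ω => g (x + Y ω)) ∈ S.H := hY.lip_mem (hg.comp_const_add x)
  have hhmem : (fun ω => h (x + Y ω)) ∈ S.H := hY.lip_mem (hh.comp_const_add x)
  have hnmem : (fun ω => K * ‖Y ω‖) ∈ S.H := S.const_mul_mem hY.norm_mem K
  have hle : |S.E (fun ω => g (x + Y ω) + a) - S.E (fun ω => h (x + Y ω))| ≤
      S.E fun ω => K * ‖Y ω‖ + b := by
    refine S.abs_E_sub_le (S.H.add_mem hgmem (S.const_mem a)) hhmem
      (S.H.add_mem hnmem (S.const_mem b)) fun ω => ?_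
    simpa only [add_sub_cancel_left, add_sub_right_comm, add_comm b] using hgh (x + Y ω)
  rw [S.E_add_const hgmem, S.E_add_const hnmem, S.E_const_mul hY.norm_mem hK] at hle
  simpa only [transition, add_sub_right_comm, add_comm b] using hle

variable {X : ℝ≥0 → Ω → V} {φ : V → ℝ} {ψ : ℝ → V → ℝ} {t : ℝ≥0}

theorem IsLevy.tendsto_time_remainder (hX : S.IsLevy X)
    (hX0 : Tendsto (fun t => S.E fun ω => ‖X t ω‖) (𝓝 0) (𝓝 0)) (hψ : IsCb23 ψ) (ht : 0 < t)
    (x : V) :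
    Tendsto (fun δ : ℝ≥0 => (S.transition (X δ) (ψ (t - δ : ℝ≥0)) x - S.transition (X δ) (ψ t) x +
      δ * deriv (fun s => ψ s x) t) / δ) (𝓝[>] 0) (𝓝 0) := by
  refine Metric.tendsto_nhds.2 fun ε hε => ?_
  obtain ⟨K, hK, hexp⟩ := hψ.exists_time_expansion (NNReal.coe_pos.2 ht) x (half_pos hε)
  have hsmall : Tendsto (fun δ : ℝ≥0 => K * (δ + S.E fun ω => ‖X δ ω‖)) (𝓝 0) (𝓝 0) := by
    simpa using ((NNReal.continuous_coe.tendsto 0).add hX0).const_mul K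
  filter_upwards [nhdsWithin_le_nhds (hsmall.eventually_lt_const (half_pos hε)),
    Ioo_mem_nhdsGT ht] with δ hδ ⟨hδ0, hδt⟩
  have hδpos : (0 : ℝ) < δ := hδ0
  have hle := (hX.mem δ).abs_transition_sub_add_le (x := x) (K := δ * K)
    (b := δ * (ε / 2 + K * δ)) (hψ.isCb (NNReal.coe_pos.2 (tsub_pos_of_lt hδt))).isLip
    (hψ.isCb (NNReal.coe_pos.2 ht)).isLip (by positivity) fun z => by
      rw [NNReal.coe_sub hδt.le]
      exact (hexp δ δ.2 hδt z).trans_eq (by ring)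
  rw [Real.dist_0_eq_abs, abs_div, abs_of_pos hδpos, div_lt_iff₀ hδpos]
  calc _ ≤ δ * (ε / 2 + K * δ) + δ * K * S.E fun ω => ‖X δ ω‖ := hle
    _ = (ε / 2 + K * (δ + S.E fun ω => ‖X δ ω‖)) * δ := by ring
    _ < ε * δ := by
      gcongr
      linarith

theorem IsLevy.tendsto_transition_sub_div (hX : S.IsLevy X)
    (hX0 : Tendsto (fun t => S.E fun ω => ‖X t ω‖) (𝓝 0) (𝓝 0)) (hψ : IsCb23 ψ) (ht : 0 < t)
    (x : V) :
    Tendsto (fun δ : ℝ≥0 => (S.transition (X δ) (ψ (t - δ : ℝ≥0)) x - ψ t x) / δ) (𝓝[>] 0)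
      (𝓝 (S.generator X (fun z => ψ t (x + z) - ψ t x) - deriv (fun s => ψ s x) t)) := by
  have hψt : IsCb 3 (ψ t) := hψ.isCb (NNReal.coe_pos.2 ht)
  have hincr (δ : ℝ≥0) :
      S.E (fun ω => ψ t (x + X δ ω) - ψ t x) = S.transition (X δ) (ψ t) x - ψ t x := by
    simp only [sub_eq_add_neg]
    exact S.E_add_const ((hX.mem δ).lip_mem (hψt.isLip.comp_const_add x)) _
  have hgen := hX.tendsto_generator hX0 (hψt.comp_const_add_sub_const x (ψ t x))
    (by rw [add_zero, sub_self])
  have hlim := ((hX.tendsto_time_remainder hX0 hψ ht x).add hgen).sub_const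
    (deriv (fun s => ψ s x) t)
  rw [zero_add] at hlim
  refine hlim.congr' ?_
  filter_upwards [self_mem_nhdsWithin] with δ hδ
  have hδ0 : (δ : ℝ) ≠ 0 := (NNReal.coe_pos.2 hδ).ne'
  rw [hincr]
  field_simp
  ring

theorem IsLevy.deriv_sub_generator_nonpos (hX : S.IsLevy X)
    (hX0 : Tendsto (fun t => S.E fun ω => ‖X t ω‖) (𝓝 0) (𝓝 0)) (hφ : IsLip φ) (hψ : IsCb23 ψ)
    (ht : 0 < t) {x : V} (hle : ∀ (s : ℝ≥0) y, 0 < s → S.transition (X s) φ y ≤ ψ s y)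
    (heq : ψ t x = S.transition (X t) φ x) :
    deriv (fun s => ψ s x) t - S.generator X (fun z => ψ t (x + z) - ψ t x) ≤ 0 := by
  obtain ⟨K, hK⟩ := hφ
  refine sub_nonpos.2 (sub_nonneg.1 (ge_of_tendsto (hX.tendsto_transition_sub_div hX0 hψ ht x) ?_))
  filter_upwards [Ioo_mem_nhdsGT ht] with δ ⟨_, hδt⟩
  have hpos : 0 < t - δ := tsub_pos_of_lt hδt
  refine div_nonneg (sub_nonneg.2 ?_) δ.2
  calc ψ t x = S.transition (X δ) (S.transition (X (t - δ)) φ) x := by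
        rw [heq, ← hX.transition_add δ (t - δ) ⟨K, hK⟩, add_tsub_cancel_of_le hδt.le]
    _ ≤ S.transition (X δ) (ψ (t - δ : ℝ≥0)) x :=
        (hX.mem δ).transition_mono ⟨K, (hX.mem _).lipschitzWith_transition hK⟩
          (hψ.isCb (NNReal.coe_pos.2 hpos)).isLip (fun y => hle _ y hpos) x

theorem IsLevy.deriv_sub_generator_nonneg (hX : S.IsLevy X)
    (hX0 : Tendsto (fun t => S.E fun ω => ‖X t ω‖) (𝓝 0) (𝓝 0)) (hφ : IsLip φ) (hψ : IsCb23 ψ)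
    (ht : 0 < t) {x : V} (hle : ∀ (s : ℝ≥0) y, 0 < s → ψ s y ≤ S.transition (X s) φ y)
    (heq : ψ t x = S.transition (X t) φ x) :
    0 ≤ deriv (fun s => ψ s x) t - S.generator X (fun z => ψ t (x + z) - ψ t x) := by
  obtain ⟨K, hK⟩ := hφ
  refine sub_nonneg.2 (sub_nonpos.1 (le_of_tendsto (hX.tendsto_transition_sub_div hX0 hψ ht x) ?_))
  filter_upwards [Ioo_mem_nhdsGT ht] with δ ⟨_, hδt⟩
  have hpos : 0 < t - δ := tsub_pos_of_lt hδt
  refine div_nonpos_of_nonpos_of_nonneg (sub_nonpos.2 ?_) δ.2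
  calc S.transition (X δ) (ψ (t - δ : ℝ≥0)) x
      ≤ S.transition (X δ) (S.transition (X (t - δ)) φ) x :=
        (hX.mem δ).transition_mono (hψ.isCb (NNReal.coe_pos.2 hpos)).isLip
          ⟨K, (hX.mem _).lipschitzWith_transition hK⟩ (fun y => hle _ y hpos) x
    _ = ψ t x := by
        rw [heq, ← hX.transition_add δ (t - δ) ⟨K, hK⟩, add_tsub_cancel_of_le hδt.le]

theorem IsRandomVector.abs_transition_le {Y : Ω → V} (hY : S.IsRandomVector Y) (hφ : IsLip φ)
    {M : ℝ} (hM : ∀ x, |φ x| ≤ M) (x : V) : |S.transition Y φ x| ≤ M := by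
  rw [← S.const M, ← sub_zero (S.transition Y φ x), ← S.const 0]
  refine S.abs_E_sub_le (hY.lip_mem (hφ.comp_const_add x)) (S.const_mem 0) (S.const_mem M)
    fun ω => ?_
  rw [sub_zero]
  exact hM _

theorem IsLevy.isViscositySolution (hX : S.IsLevy X)
    (hX0 : Tendsto (fun t => S.E fun ω => ‖X t ω‖) (𝓝 0) (𝓝 0)) (hφ : IsBddLip φ) :
    IsViscositySolution (S.generator X) φ fun t => S.transition (X t) φ := by
  obtain ⟨hlip, M, hM⟩ := hφ
  have hbdd : ∃ M : ℝ, ∀ t x, |S.transition (X t) φ x| ≤ M :=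
    ⟨M, fun t x => (hX.mem t).abs_transition_le hlip hM x⟩
  have hcont := hX.continuous_transition hX0 hlip
  have hinit (x : V) : S.transition (X 0) φ x = φ x := by
    simp only [transition, hX.zero, add_zero, S.const]
  exact
    { bdd := hbdd
      cont := hcont
      sub :=
        { bdd := hbdd
          usc := hcont.upperSemicontinuous
          init := fun x => (hinit x).le
          sub := fun t x ht ψ hψ hle heq =>
            hX.deriv_sub_generator_nonpos hX0 hlip hψ ht hle heq }
      super :=
        { bdd := hbdd
          lsc := hcont.lowerSemicontinuous
          init := fun x => (hinit x).ge
          super := fun t x ht ψ hψ hle heq =>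
            hX.deriv_sub_generator_nonneg hX0 hlip hψ ht hle heq } }

end Viscosity

end SublinearExpectationSpace

theorem le_add_cube_div_sq {r η : ℝ} (hr : 0 ≤ r) (hη : 0 < η) : r ≤ η + r ^ 3 / η ^ 2 := by
  rcases le_total r η with h | h
  · exact h.trans (le_add_of_nonneg_right (by positivity))
  · refine le_add_of_nonneg_of_le hη.le ((le_div_iff₀ (by positivity)).2 ?_)
    calc r * η ^ 2 ≤ r * r ^ 2 := by gcongr
      _ = r ^ 3 := by ring

namespace SublinearExpectationSpace

section GLevy

variable {Ω : Type u} {S : SublinearExpectationSpace Ω} {V : Type*} [NormedAddCommGroup V]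
  [NormedSpace ℝ V] [FiniteDimensional ℝ V] {X Xc Xd : ℝ≥0 → Ω → V}

theorem IsGLevyPair.tendsto_E_norm_continuousPart (h : S.IsGLevyPair Xc Xd) :
    Tendsto (fun t => S.E fun ω => ‖Xc t ω‖) (𝓝[>] 0) (𝓝 0) := by
  have hXc (t : ℝ≥0) : S.IsRandomVector (Xc t) :=
    (h.levy.map (ContinuousLinearMap.fst ℝ V V)).mem t
  have hcube : Tendsto (fun t => S.E fun ω => ‖Xc t ω‖ ^ 3) (𝓝[>] 0) (𝓝 0) := by
    have hcoe : Tendsto (fun t : ℝ≥0 => (t : ℝ)) (𝓝[>] 0) (𝓝 0) :=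
      (NNReal.continuous_coe.tendsto 0).mono_left nhdsWithin_le_nhds
    have hmul := h.cube_lim.mul hcoe
    rw [zero_mul] at hmul
    refine hmul.congr' ?_
    filter_upwards [self_mem_nhdsWithin] with t ht
    exact div_mul_cancel₀ _ (NNReal.coe_pos.2 ht).ne'
  refine Metric.tendsto_nhds.2 fun ε hε => ?_
  have hη := half_pos hε
  have hlim := hcube.const_mul (((ε / 2) ^ 2)⁻¹)
  rw [mul_zero] at hlim
  filter_upwards [h.cube_mem, hlim.eventually_lt_const hη] with t hmem hlt
  rw [Real.dist_0_eq_abs,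
    abs_of_nonneg (S.E_nonneg (hXc t).norm_mem fun ω => norm_nonneg _)]
  have hcmem := S.const_mul_mem hmem ((ε / 2) ^ 2)⁻¹
  calc S.E (fun ω => ‖Xc t ω‖)
      ≤ S.E (fun ω => ((ε / 2) ^ 2)⁻¹ * ‖Xc t ω‖ ^ 3 + ε / 2) :=
        S.E_mono (hXc t).norm_mem (S.H.add_mem hcmem (S.const_mem _)) fun ω =>
          (le_add_cube_div_sq (norm_nonneg _) hη).trans_eq (by ring)
    _ = ((ε / 2) ^ 2)⁻¹ * S.E (fun ω => ‖Xc t ω‖ ^ 3) + ε / 2 := by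
        rw [S.E_add_const hcmem, S.E_const_mul hmem (by positivity)]
    _ < ε := by linarith

theorem IsGLevyPair.tendsto_E_norm_add (h : S.IsGLevyPair Xc Xd) :
    Tendsto (fun t => S.E fun ω => ‖Xc t ω + Xd t ω‖) (𝓝[>] 0) (𝓝 0) := by
  obtain ⟨C, hC⟩ := h.jump_bound
  have hXc (t : ℝ≥0) : S.IsRandomVector (Xc t) :=
    (h.levy.map (ContinuousLinearMap.fst ℝ V V)).mem t
  have hXd (t : ℝ≥0) : S.IsRandomVector (Xd t) :=
    (h.levy.map (ContinuousLinearMap.snd ℝ V V)).mem t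
  have hsum (t : ℝ≥0) : S.IsRandomVector fun ω => Xc t ω + Xd t ω :=
    (h.levy.map (ContinuousLinearMap.fst ℝ V V + ContinuousLinearMap.snd ℝ V V)).mem t
  have hbound (t : ℝ≥0) :
      S.E (fun ω => ‖Xc t ω + Xd t ω‖) ≤ S.E (fun ω => ‖Xc t ω‖) + C * t :=
    calc S.E (fun ω => ‖Xc t ω + Xd t ω‖)
        ≤ S.E (fun ω => ‖Xc t ω‖ + ‖Xd t ω‖) :=
          S.E_mono (hsum t).norm_mem (S.H.add_mem (hXc t).norm_mem (hXd t).norm_mem)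
            fun ω => norm_add_le _ _
      _ ≤ S.E (fun ω => ‖Xc t ω‖) + S.E (fun ω => ‖Xd t ω‖) :=
          S.E_add_le (hXc t).norm_mem (hXd t).norm_mem
      _ ≤ S.E (fun ω => ‖Xc t ω‖) + C * t := add_le_add le_rfl (hC t)
  have hjump : Tendsto (fun t : ℝ≥0 => C * t) (𝓝[>] 0) (𝓝 0) :=
    (Continuous.tendsto' (by fun_prop) _ _ (by simp)).mono_left nhdsWithin_le_nhds
  refine squeeze_zero (fun t => S.E_nonneg (hsum t).norm_mem fun ω => norm_nonneg _) hbound ?_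
  simpa only [add_zero] using h.tendsto_E_norm_continuousPart.add hjump

theorem IsGLevy.tendsto_E_norm (hX : S.IsGLevy X) :
    Tendsto (fun t => S.E fun ω => ‖X t ω‖) (𝓝 0) (𝓝 0) := by
  obtain ⟨Ω', S', Xc, Xd, hpair, hdist⟩ := hX.decomp
  have hnorm (t : ℝ≥0) : S.E (fun ω => ‖X t ω‖) = S'.E fun ω => ‖Xc t ω + Xd t ω‖ :=
    hdist 1 (fun _ => t) (fun x => ‖x 0‖) (IsLip.norm.comp (LipschitzWith.eval 0))
  have h0 : S.E (fun ω => ‖X 0 ω‖) = 0 := by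
    simp only [hX.levy.zero, norm_zero, S.const]
  have hright : ContinuousWithinAt (fun t => S.E fun ω => ‖X t ω‖) (Set.Ioi 0) 0 := by
    rw [ContinuousWithinAt, h0]
    simpa only [hnorm] using hpair.tendsto_E_norm_add
  have hcont := continuousWithinAt_Ioi_iff_Ici.1 hright
  rwa [← bot_eq_zero, Set.Ici_bot, ContinuousWithinAt, nhdsWithin_univ, bot_eq_zero, h0]
    at hcont

end GLevy

end SublinearExpectationSpace

theorem mainTheorem2_general {Ω : Type*} (S : SublinearExpectationSpace Ω) {V : Type*}
    [NormedAddCommGroup V] [NormedSpace ℝ V] [FiniteDimensional ℝ V] {X : ℝ≥0 → Ω → V}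
    (hX : S.IsLevy X) (hX0 : Tendsto (fun t => S.E fun ω => ‖X t ω‖) (𝓝 0) (𝓝 0)) :
    (∀ f : V → ℝ, IsCb 3 f → f 0 = 0 →
      Tendsto (fun δ : ℝ≥0 => S.E (fun ω => f (X δ ω)) / (δ : ℝ)) (𝓝[>] 0)
        (𝓝 (S.generator X f))) ∧
    ∀ φ : V → ℝ, IsBddLip φ →
      IsViscositySolution (S.generator X) φ (fun t x => S.E (fun ω => φ (x + X t ω))) :=
  ⟨fun _ hf hf0 => hX.tendsto_generator hX0 hf hf0, fun _ hφ => hX.isViscositySolution hX0 hφ⟩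

theorem mainTheorem2 {Ω : Type u} (S : SublinearExpectationSpace Ω) (d : ℕ)
    (X : ℝ≥0 → Ω → EuclideanSpace ℝ (Fin d)) (hX : S.IsGLevy X) :
    (∀ f : EuclideanSpace ℝ (Fin d) → ℝ, IsCb 3 f → f 0 = 0 →
      Tendsto (fun δ : ℝ≥0 => S.E (fun ω => f (X δ ω)) / (δ : ℝ)) (𝓝[>] 0)
        (𝓝 (S.generator X f))) ∧
    ∀ φ : EuclideanSpace ℝ (Fin d) → ℝ, IsBddLip φ →
      IsViscositySolution (S.generator X) φ (fun t x => S.E (fun ω => φ (x + X t ω))) :=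
  mainTheorem2_general S hX.levy hX.tendsto_E_norm
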